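/- For each $N\ge 1$ let $\Omega_N$ be the space of real symmetric $N\times N$ matrices and let $\mathbb{P}_N$ be the probability measure on $\Omega_N$ given by $$d\mathbb{P}_N(A)=c_N\exp\Bigl(-\frac N4\operatorname{Tr}(A^2)\Bigr)\prod_{i\le j}dx_{ij},\qquad A=(x_{ij})_{i,j=1}^N,$$ where $c_N$ is the normalization constant. (Equivalently, the entries $x_{ij}$, $i\le j$, are independent centered real Gaussian random variables with $E[x_{ij}^2]=\frac1N$ for $i<j$ and $E[x_{ii}^2]=\frac2N$.) For each $N\ge1$ let $A_N$ be a GOE random matrix, i.e. a random real symmetric $N\times N$ matrix, defined on some probability space, with law $\mathbb{P}_N$. For a real symmetric $N\times N$ matrix $A$ with eigenvalues $\lambda_1,\dots,\lambda_N$, counted with multiplicity, let $\mu_A=\frac1N\sum_{i=1}^N\delta_{\lambda_i}$ be its eigenvalue distribution, and let $\mu_N:=E[\mu_{A_N}]$, i.e. $\mu_N(B)=E[\mu_{A_N}(B)]$ for Borel sets $B\subseteq\mathbb{R}$, be the averaged eigenvalue distribution. Let $\mu_W$ be the semicircle distribution, $d\mu_W(t)=\frac1{2\pi}\sqrt{4-t^2}\,dt$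 on $[-2,2]$. Then $\mu_N$ ($N\ge1$) and $\mu_W$ are probability measures on $\mathbb{R}$, and $\mu_N$ converges weakly to $\mu_W$ as $N\to\infty$: $$\lim_{N\to\infty}\int_{\mathbb{R}} f\,d\mu_N=\int_{\mathbb{R}} f\,d\mu_W\qquad\text{for every bounded continuous } f:\mathbb{R}\to\mathbb{R}.$$ -/

import Mathlib

open MeasureTheory ProbabilityTheory Filter Topology
open scoped ENNReal BoundedContinuousFunction

noncomputable section

/-- The product (equivalently, Borel) σ-algebra on the real `N × N` matrices. -/
instance matrixMeasurableSpace (N : ℕ) : MeasurableSpace (Matrix (Fin N) (Fin N) ℝ) :=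
  inferInstanceAs (MeasurableSpace (Fin N → Fin N → ℝ))

/-- The space `Ω_N` of real symmetric `N × N` matrices, with the Borel σ-algebra inherited from
the space of all real matrices. -/
abbrev SymmMatrix (N : ℕ) : Type := {A : Matrix (Fin N) (Fin N) ℝ // A.IsSymm}

/-- The index set of the free entries `x_{ij}`, `i ≤ j`. -/
abbrev UpperIndex (N : ℕ) : Type := {p : Fin N × Fin N // p.1 ≤ p.2}

/-- The symmetric matrix with prescribed entries `x_{ij}`, `i ≤ j`. -/
def symmOfUpper (N : ℕ) (x : UpperIndex N → ℝ) : SymmMatrix N :=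
  ⟨Matrix.of fun i j => x ⟨(min i j, max i j), min_le_max⟩, by
    ext i j
    simp only [Matrix.transpose_apply, Matrix.of_apply, min_comm, max_comm]⟩

/-- The measure `∏_{i ≤ j} dx_{ij}` on the symmetric matrices. -/
def symmLebesgue (N : ℕ) : Measure (SymmMatrix N) :=
  (volume : Measure (UpperIndex N → ℝ)).map (symmOfUpper N)

/-- The unnormalized density `exp (-(N/4) Tr (A²))`. -/
def goeWeight (N : ℕ) (A : SymmMatrix N) : ℝ≥0∞ :=
  ENNReal.ofReal (Real.exp (-((N : ℝ) / 4) * (A.1 ^ 2).trace))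

/-- The law of the Gaussian orthogonal ensemble:
`dP_N(A) = c_N exp (-(N/4) Tr (A²)) ∏_{i ≤ j} dx_{ij}`, where `c_N` is the normalization
constant. -/
def goe (N : ℕ) : Measure (SymmMatrix N) :=
  (∫⁻ A, goeWeight N A ∂symmLebesgue N)⁻¹ • (symmLebesgue N).withDensity (goeWeight N)

theorem SymmMatrix.isHermitian {N : ℕ} (A : SymmMatrix N) : A.1.IsHermitian := by
  rw [Matrix.IsHermitian, Matrix.conjTranspose_eq_transpose_of_trivial]
  exact A.2

/-- The eigenvalue distribution `μ_A = (1/N) ∑ δ_{λ_i}`, where `λ_1, …, λ_N` are the eigenvalues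
of `A` counted with multiplicity. -/
def eigenvalueDistribution {N : ℕ} (A : SymmMatrix N) : Measure ℝ :=
  (N : ℝ≥0∞)⁻¹ • ∑ i : Fin N, Measure.dirac (A.isHermitian.eigenvalues i)

/-- The averaged eigenvalue distribution `E[μ_A]` of a random symmetric matrix `A`, i.e. the
measure `B ↦ E[μ_A(B)]`. -/
def averagedEigenvalueDistribution {Ω : Type*} [MeasurableSpace Ω] (P : Measure Ω) {N : ℕ}
    (A : Ω → SymmMatrix N) : Measure ℝ :=
  P.bind fun ω => eigenvalueDistribution (A ω)

/-- The standard semicircle distribution, with density `√(4 - x²) / (2π)` on `[-2, 2]`. -/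
def semicircle : Measure ℝ :=
  (volume.restrict (Set.Icc (-2) 2)).withDensity fun x =>
    ENNReal.ofReal (1 / (2 * Real.pi) * Real.sqrt (4 - x ^ 2))

/-- Weak convergence of finite measures on `ℝ`: convergence of the integrals of all bounded
continuous functions. -/
def ConvergesWeakly (μs : ℕ → Measure ℝ) (μ : Measure ℝ) : Prop :=
  ∀ f : ℝ →ᵇ ℝ, Tendsto (fun N => ∫ t, f t ∂μs N) atTop (𝓝 (∫ t, f t ∂μ))

end

/-! The proof is the method of moments. The `k`-th moment of the averaged eigenvalue distribution is
`E[t_k]` with `t_k = (1/N) Tr (X^k)`, a polynomial in independent Gaussian entries, so no eigenvalue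
density is needed.

Writing `Tr (X^(k+1)) = ∑ X_ij (X^k)_ji` and integrating by parts in the factor `X_ij` gives the
Schwinger–Dyson equation `goeExpectation_normTracePow_succ_mul`. It expresses `E[t_(k+1) f]` through
`∑ E[t_m t_(k-1-m) f]`, up to terms carrying a factor `1/N`. To close the recursion, `f` ranges over
products of the `t_a`. Induction on the total degree (`tendsto_goeExpectation_prod`) shows that
mixed moments factorize in the limit and that the limits obey the Catalan recursion. Those limits
are the semicircle moments (`integral_pow_semicircle`).

Convergence of moments gives weak convergence (`tendsto_integral_semicircle_of_moments`) because the
limit lives on `[-2, 2]`: a bounded continuous function is approximated by a polynomial on `[-3,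
3]`, and the tail is absorbed by a high even moment. -/

/-! ### Gaussian integrals and integration by parts. -/

section Gaussian

theorem integrable_pow_mul_exp_neg_mul_sq {b : ℝ} (hb : 0 < b) (n : ℕ) :
    Integrable fun x : ℝ => x ^ n * Real.exp (-b * x ^ 2) := by
  have h := integrable_rpow_mul_exp_neg_mul_sq hb (s := n) (by
    have : (0 : ℝ) ≤ n := n.cast_nonneg
    linarith)
  simpa using h

/-- Integration by parts, with `x * exp (-b x²)` as the derivative of `-(2b)⁻¹ exp (-b x²)`. At `n =
0` the truncated exponent `n - 1` is harmless, since its coefficient is zero. -/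
theorem integral_pow_succ_mul_exp_neg_mul_sq {b : ℝ} (hb : 0 < b) (n : ℕ) :
    ∫ x : ℝ, x ^ (n + 1) * Real.exp (-b * x ^ 2) =
      (2 * b)⁻¹ * (n * ∫ x : ℝ, x ^ (n - 1) * Real.exp (-b * x ^ 2)) := by
  have hv (x : ℝ) : HasDerivAt (fun x : ℝ => -(2 * b)⁻¹ * Real.exp (-b * x ^ 2))
      (x * Real.exp (-b * x ^ 2)) x := by
    have h := (((hasDerivAt_pow 2 x).const_mul (-b)).exp).const_mul (-(2 * b)⁻¹)
    refine h.congr_deriv ?_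
    field_simp
    simp
  have h := integral_mul_deriv_eq_deriv_mul_of_integrable (u := fun x : ℝ => x ^ n)
    (fun x _ => hasDerivAt_pow n x) (fun x _ => hv x) ?_ ?_ ?_
  · rw [← integral_const_mul, ← integral_const_mul]
    calc _ = ∫ x : ℝ, x ^ n * (x * Real.exp (-b * x ^ 2)) := by
          congr with x; ring
      _ = _ := h
      _ = _ := by
          rw [← integral_neg]
          congr with x; ring
  · convert integrable_pow_mul_exp_neg_mul_sq hb (n + 1) using 1
    ext x; simp; ring
  · convert (integrable_pow_mul_exp_neg_mul_sq hb (n - 1)).const_mul (-(2 * b)⁻¹ * n) using 1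
    ext x; simp; ring
  · convert (integrable_pow_mul_exp_neg_mul_sq hb n).const_mul (-(2 * b)⁻¹) using 1
    ext x; simp; ring

variable {σ : Type*} [Fintype σ]

/-- The Gaussian weight `exp (-∑ b_p x_p²)`. -/
noncomputable def gaussianWeight (b : σ → ℝ) (x : σ → ℝ) : ℝ := Real.exp (-∑ p, b p * x p ^ 2)

/-- The centred Gaussian measure with density proportional to `exp (-∑ b_p x_p²)`. -/
noncomputable def gaussianMeasure (b : σ → ℝ) : Measure (σ → ℝ) :=
  (∫⁻ x, ENNReal.ofReal (gaussianWeight b x))⁻¹ •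
    (volume : Measure (σ → ℝ)).withDensity fun x => ENNReal.ofReal (gaussianWeight b x)

theorem measurable_gaussianWeight (b : σ → ℝ) : Measurable (gaussianWeight b) := by
  unfold gaussianWeight
  fun_prop

theorem gaussianWeight_eq_prod (b x : σ → ℝ) :
    gaussianWeight b x = ∏ p, Real.exp (-b p * x p ^ 2) := by
  rw [gaussianWeight, ← Real.exp_sum]
  simp

theorem gaussianWeight_pos (b x : σ → ℝ) : 0 < gaussianWeight b x := Real.exp_pos _

variable {b : σ → ℝ}

theorem integrable_gaussianWeight (hb : ∀ p, 0 < b p) : Integrable (gaussianWeight b) := by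
  simp_rw [funext (gaussianWeight_eq_prod b)]
  exact Integrable.fintype_prod (f := fun p (t : ℝ) => Real.exp (-b p * t ^ 2))
    fun p => integrable_exp_neg_mul_sq (hb p)

theorem lintegral_gaussianWeight_ne_top (hb : ∀ p, 0 < b p) :
    ∫⁻ x, ENNReal.ofReal (gaussianWeight b x) ≠ ∞ :=
  (integrable_gaussianWeight hb).lintegral_lt_top.ne

theorem lintegral_gaussianWeight_ne_zero (b : σ → ℝ) :
    ∫⁻ x, ENNReal.ofReal (gaussianWeight b x) ≠ 0 := by
  rw [Ne, lintegral_eq_zero_iff (measurable_gaussianWeight b).ennreal_ofReal]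
  intro h
  obtain ⟨x, hx⟩ := h.exists
  simp [(gaussianWeight_pos b x).not_ge] at hx

theorem isProbabilityMeasure_gaussianMeasure (hb : ∀ p, 0 < b p) :
    IsProbabilityMeasure (gaussianMeasure b) := by
  constructor
  rw [gaussianMeasure, Measure.smul_apply, withDensity_apply _ .univ, Measure.restrict_univ,
    smul_eq_mul]
  exact ENNReal.inv_mul_cancel (lintegral_gaussianWeight_ne_zero b)
    (lintegral_gaussianWeight_ne_top hb)

theorem integral_gaussianMeasure (b : σ → ℝ) (f : (σ → ℝ) → ℝ) :
    ∫ x, f x ∂gaussianMeasure b =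
      (∫⁻ x, ENNReal.ofReal (gaussianWeight b x)).toReal⁻¹ * ∫ x, f x * gaussianWeight b x := by
  rw [gaussianMeasure, integral_smul_measure,
    integral_withDensity_eq_integral_toReal_smul
      (measurable_gaussianWeight b).ennreal_ofReal (by simp), ENNReal.toReal_inv, smul_eq_mul]
  congr with x
  rw [ENNReal.toReal_ofReal (gaussianWeight_pos b x).le, smul_eq_mul, mul_comm]

theorem monomial_mul_gaussianWeight (m : σ →₀ ℕ) (b x : σ → ℝ) (r : ℝ) :
    MvPolynomial.eval x (MvPolynomial.monomial m r) * gaussianWeight b x =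
      r * ∏ p, (x p ^ m p * Real.exp (-b p * x p ^ 2)) := by
  rw [MvPolynomial.eval_monomial, gaussianWeight_eq_prod, Finsupp.prod_fintype _ _ (by simp),
    Finset.prod_mul_distrib, mul_assoc]

theorem integrable_eval_mul_gaussianWeight (hb : ∀ p, 0 < b p) (f : MvPolynomial σ ℝ) :
    Integrable fun x => MvPolynomial.eval x f * gaussianWeight b x := by
  induction f using MvPolynomial.induction_on' with
  | monomial m r =>
    simp_rw [monomial_mul_gaussianWeight]
    exact (Integrable.fintype_prod (f := fun p (t : ℝ) => t ^ m p * Real.exp (-b p * t ^ 2))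
      fun p => integrable_pow_mul_exp_neg_mul_sq (hb p) _).const_mul r
  | add f g hf hg =>
    simp_rw [map_add, add_mul]
    exact hf.add hg

theorem integrable_eval_gaussianMeasure (hb : ∀ p, 0 < b p) (f : MvPolynomial σ ℝ) :
    Integrable (fun x => MvPolynomial.eval x f) (gaussianMeasure b) := by
  refine Integrable.smul_measure ?_
    (ENNReal.inv_ne_top.2 (lintegral_gaussianWeight_ne_zero b))
  rw [integrable_withDensity_iff (measurable_gaussianWeight b).ennreal_ofReal (by simp)]
  simp_rw [ENNReal.toReal_ofReal (gaussianWeight_pos b _).le]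
  exact integrable_eval_mul_gaussianWeight hb f

theorem integral_monomial_mul_gaussianWeight (m : σ →₀ ℕ) (r : ℝ) :
    ∫ x, MvPolynomial.eval x (MvPolynomial.monomial m r) * gaussianWeight b x =
      r * ∏ p, ∫ t : ℝ, t ^ m p * Real.exp (-b p * t ^ 2) := by
  simp_rw [monomial_mul_gaussianWeight]
  rw [integral_const_mul,
    integral_fintype_prod_volume_eq_prod fun p (t : ℝ) => t ^ m p * Real.exp (-b p * t ^ 2)]

/-- Gaussian integration by parts for polynomials. -/
theorem integral_X_mul_gaussianMeasure (hb : ∀ p, 0 < b p) (p : σ) (f : MvPolynomial σ ℝ) :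
    ∫ x, MvPolynomial.eval x (MvPolynomial.X p * f) ∂gaussianMeasure b =
      (2 * b p)⁻¹ * ∫ x, MvPolynomial.eval x (MvPolynomial.pderiv p f) ∂gaussianMeasure b := by
  classical
  induction f using MvPolynomial.induction_on' with
  | monomial m r =>
    rw [integral_gaussianMeasure, integral_gaussianMeasure, mul_left_comm]
    congr 1
    rw [MvPolynomial.pderiv_monomial, MvPolynomial.X, MvPolynomial.monomial_mul,
      integral_monomial_mul_gaussianWeight, integral_monomial_mul_gaussianWeight,
      ← Finset.mul_prod_erase _ _ (Finset.mem_univ p),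
      ← Finset.mul_prod_erase _ (fun q => ∫ t : ℝ, t ^ ((m - Finsupp.single p 1 : σ →₀ ℕ) q) * _)
        (Finset.mem_univ p)]
    -- The integral of a monomial splits into one-dimensional integrals. Only the factor at `p`
    -- differs between the two sides.
    have h : ∀ q ∈ Finset.univ.erase p,
        ∫ t : ℝ, t ^ ((Finsupp.single p 1 + m : σ →₀ ℕ) q) * Real.exp (-b q * t ^ 2) =
        ∫ t : ℝ, t ^ ((m - Finsupp.single p 1 : σ →₀ ℕ) q) * Real.exp (-b q * t ^ 2) := by
      intro q hq
      have hq : p ≠ q := (Finset.ne_of_mem_erase hq).symm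
      simp [hq]
    rw [Finset.prod_congr rfl h]
    simp only [Finsupp.add_apply, Finsupp.single_eq_same, Finsupp.tsub_apply]
    rw [add_comm, integral_pow_succ_mul_exp_neg_mul_sq (hb p)]
    ring
  | add f g hf hg =>
    simp only [mul_add, map_add] at hf hg ⊢
    rw [integral_add (integrable_eval_gaussianMeasure hb _)
      (integrable_eval_gaussianMeasure hb _), integral_add (integrable_eval_gaussianMeasure hb _)
      (integrable_eval_gaussianMeasure hb _), hf, hg, mul_add]

end Gaussian

/-! ### Derivations applied entrywise to matrix powers. -/

section MatrixDerivation

variable {n R : Type*} [Fintype n] [CommRing R] [Algebra ℝ R]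

theorem Derivation.map_matrix_mul (D : Derivation ℝ R R) (A B : Matrix n n R) :
    (A * B).map D = A * B.map D + A.map D * B := by
  ext i j
  simp [Matrix.mul_apply, Finset.sum_add_distrib, mul_comm]

variable [DecidableEq n]

theorem Derivation.map_matrix_pow (D : Derivation ℝ R R) (A : Matrix n n R) (k : ℕ) :
    (A ^ k).map D = ∑ m ∈ Finset.range k, A ^ m * A.map D * A ^ (k - 1 - m) := by
  induction k with
  | zero => ext i j; simp [Matrix.one_apply, apply_ite D]
  | succ k ih =>
    rw [pow_succ, D.map_matrix_mul, ih, Finset.sum_range_succ, Finset.sum_mul, add_comm]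
    congr 1
    · refine Finset.sum_congr rfl fun m hm => ?_
      have := Finset.mem_range.1 hm
      rw [mul_assoc _ _ A, ← pow_succ]
      congr 2
      omega
    · simp

theorem Matrix.mul_single_mul_apply {R : Type*} [CommRing R] (A B : Matrix n n R) (i j k l : n) :
    (A * (Matrix.single i j 1 : Matrix n n R) * B) k l = A k i * B j l := by
  simp [Matrix.mul_apply, Matrix.single_apply, ite_and]

/-- Under the trace, cyclicity makes all `k` terms of the noncommutative Leibniz sum equal. -/
theorem Derivation.map_trace_pow (D : Derivation ℝ R R) (A : Matrix n n R) (k : ℕ) :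
    D (A ^ k).trace = k * (A.map D * A ^ (k - 1)).trace := by
  have h : D (A ^ k).trace = ((A ^ k).map D).trace := by simp [Matrix.trace]
  rw [h, D.map_matrix_pow, Matrix.trace_sum, Finset.sum_congr rfl, Finset.sum_const,
    Finset.card_range, nsmul_eq_mul]
  intro m hm
  have := Finset.mem_range.1 hm
  rw [Matrix.trace_mul_comm, ← mul_assoc, ← pow_add, Matrix.trace_mul_comm]
  congr 3
  omega

end MatrixDerivation

/-! ### The generic symmetric matrix and the Schwinger–Dyson equation. -/

section GenericMatrix

/-- The generic symmetric matrix, whose entries on and above the diagonal are variables. -/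
noncomputable def genericSymm (N : ℕ) :
    Matrix (Fin N) (Fin N) (MvPolynomial (UpperIndex N) ℝ) :=
  Matrix.of fun i j => MvPolynomial.X ⟨(min i j, max i j), min_le_max⟩

theorem genericSymm_isSymm (N : ℕ) : (genericSymm N).IsSymm := by
  ext i j
  simp [genericSymm, min_comm, max_comm]

theorem genericSymm_pow_apply_comm (N k : ℕ) (i j : Fin N) :
    (genericSymm N ^ k) i j = (genericSymm N ^ k) j i :=
  ((genericSymm_isSymm N).pow k).apply j i

theorem genericSymm_map_eval (N : ℕ) (x : UpperIndex N → ℝ) :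
    (genericSymm N).map (MvPolynomial.eval x) = (symmOfUpper N x).1 := by
  ext i j
  simp [genericSymm, symmOfUpper]

theorem eval_trace_genericSymm_pow (N k : ℕ) (x : UpperIndex N → ℝ) :
    MvPolynomial.eval x (genericSymm N ^ k).trace = ((symmOfUpper N x).1 ^ k).trace := by
  rw [← genericSymm_map_eval, ← RingHom.mapMatrix_apply, ← map_pow, RingHom.mapMatrix_apply]
  simp [Matrix.trace]

/-- The coefficient of `x_p²` in `(N/4) Tr (A²)`. -/
noncomputable def goeRate (N : ℕ) (p : UpperIndex N) : ℝ :=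
  if p.1.1 = p.1.2 then (N : ℝ) / 4 else (N : ℝ) / 2

theorem goeRate_pos {N : ℕ} (p : UpperIndex N) : 0 < goeRate N p := by
  have : (0 : ℝ) < N := Nat.cast_pos.2 p.1.1.pos
  unfold goeRate
  split_ifs <;> positivity

/-- The derivation `f ↦ E[x_{ij}²] ∂f/∂x_{ij}`, where `x_{ij} = x_{ji}`. -/
noncomputable def entryDerivation {N : ℕ} (i j : Fin N) :
    Derivation ℝ (MvPolynomial (UpperIndex N) ℝ) (MvPolynomial (UpperIndex N) ℝ) :=
  (2 * goeRate N ⟨(min i j, max i j), min_le_max⟩)⁻¹ •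
    MvPolynomial.pderiv ⟨(min i j, max i j), min_le_max⟩

/-- Weighting by the variance removes the case split: the diagonal variance `2/N` matches the two
matrix units coinciding when `i = j`. -/
theorem genericSymm_map_entryDerivation {N : ℕ} (i j : Fin N) :
    (genericSymm N).map (entryDerivation i j) =
      (N : ℝ)⁻¹ • (Matrix.single i j 1 + Matrix.single j i 1) := by
  have hN : (N : ℝ) ≠ 0 := (Nat.cast_pos.2 i.pos).ne'
  ext1 k l
  simp only [genericSymm, entryDerivation, Matrix.map_apply, Matrix.of_apply,
    Derivation.smul_apply, MvPolynomial.pderiv_X, Matrix.smul_apply, Matrix.add_apply,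
    Matrix.single_apply, Pi.single_apply, Subtype.mk.injEq, Prod.mk.injEq, goeRate]
  have h : (min k l = min i j ∧ max k l = max i j) ↔ (i = k ∧ j = l) ∨ (j = k ∧ i = l) := by
    rcases le_total k l with h | h <;> rcases le_total i j with h' | h' <;>
      simp only [h, h', min_eq_left, max_eq_right, min_eq_right, max_eq_left] <;> omega
  have h' : min i j = max i j ↔ i = j := by simp
  simp only [h, h']
  by_cases hij : i = j
  · subst hij
    by_cases ha : i = k ∧ i = l
    · simp only [eq_true ha, MvPolynomial.smul_eq_C_mul, or_self, if_true]
      rw [mul_one, ← MvPolynomial.C_1, ← map_add, ← map_mul]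
      congr 1
      field_simp
      norm_num
    · simp [ha]
  · rw [if_neg hij, mul_div_cancel₀ _ two_ne_zero]
    by_cases ha : i = k ∧ j = l
    · have hb : ¬ (j = k ∧ i = l) := by omega
      simp only [eq_true ha, eq_false hb, or_false, if_true, if_false, add_zero]
    · simp only [ha, false_or, if_false, zero_add]

/-- The derivation `∑ᵢⱼ (Xᵏ)ⱼᵢ E[x_{ij}²] ∂/∂x_{ij}`. -/
noncomputable def powDerivation (N k : ℕ) :
    Derivation ℝ (MvPolynomial (UpperIndex N) ℝ) (MvPolynomial (UpperIndex N) ℝ) :=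
  ∑ i, ∑ j, (genericSymm N ^ k) j i • entryDerivation i j

theorem powDerivation_apply (N k : ℕ) (f : MvPolynomial (UpperIndex N) ℝ) :
    powDerivation N k f = ∑ i, ∑ j, (genericSymm N ^ k) j i * entryDerivation i j f := by
  rw [powDerivation, ← Derivation.coeFnAddMonoidHom_apply, map_sum, Finset.sum_apply]
  simp_rw [map_sum, Finset.sum_apply]
  rfl

theorem entryDerivation_trace_pow {N : ℕ} (i j : Fin N) (a : ℕ) :
    entryDerivation i j (genericSymm N ^ a).trace =
      (2 * a / N : ℝ) • (genericSymm N ^ (a - 1)) i j := by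
  rw [Derivation.map_trace_pow, genericSymm_map_entryDerivation, Matrix.smul_mul,
    Matrix.trace_smul, add_mul, Matrix.trace_add, Matrix.trace_single_mul,
    Matrix.trace_single_mul, genericSymm_pow_apply_comm N (a - 1) j i]
  simp only [smul_eq_mul, one_mul, MvPolynomial.smul_eq_C_mul, div_eq_mul_inv, map_mul, map_natCast,
    map_ofNat]
  ring

/-- The normalized trace `(1/N) Tr (Xᵏ)` of the generic symmetric matrix. -/
noncomputable def normTracePow (N k : ℕ) : MvPolynomial (UpperIndex N) ℝ :=
  (N : ℝ)⁻¹ • (genericSymm N ^ k).trace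

/-- The factor `1/N` here is what makes distinct traces asymptotically uncorrelated. -/
theorem powDerivation_normTracePow (N k a : ℕ) :
    powDerivation N k (normTracePow N a) = (2 * a / N : ℝ) • normTracePow N (k + a - 1) := by
  rcases Nat.eq_zero_or_pos a with rfl | ha
  · simp [normTracePow]
  have h : powDerivation N k (genericSymm N ^ a).trace =
      (2 * a / N : ℝ) • (genericSymm N ^ (k + a - 1)).trace := by
    simp_rw [powDerivation_apply, entryDerivation_trace_pow]
    rw [Nat.add_sub_assoc (show 1 ≤ a from ha), pow_add, Matrix.trace_mul_comm]
    simp only [Matrix.trace, Matrix.diag, Matrix.mul_apply, Finset.smul_sum,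
      mul_smul_comm, mul_comm]
  rw [normTracePow, Derivation.map_smul, h, normTracePow, smul_comm]

/-- Of the two matrix units in the derivative of `X`, `E_ji` splits the trace into a product of two.
`E_ij` leaves, by symmetry of `X`, a single trace, which is of lower order after normalization. -/
theorem sum_entryDerivation_pow (N k : ℕ) :
    ∑ i, ∑ j, entryDerivation i j ((genericSymm N ^ k) j i) =
      (N : ℝ)⁻¹ • (∑ m ∈ Finset.range k,
        (genericSymm N ^ m).trace * (genericSymm N ^ (k - 1 - m)).trace +
          (k : ℝ) • (genericSymm N ^ (k - 1)).trace) := by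
  have h (i j : Fin N) : entryDerivation i j ((genericSymm N ^ k) j i) =
      (N : ℝ)⁻¹ • ∑ m ∈ Finset.range k,
        ((genericSymm N ^ m) j j * (genericSymm N ^ (k - 1 - m)) i i +
          (genericSymm N ^ m) i j * (genericSymm N ^ (k - 1 - m)) j i) := by
    rw [← Matrix.map_apply (M := genericSymm N ^ k) (f := entryDerivation i j), Derivation.map_matrix_pow,
      Matrix.sum_apply, Finset.smul_sum]
    refine Finset.sum_congr rfl fun m _ => ?_
    rw [genericSymm_map_entryDerivation, Matrix.mul_smul, Matrix.smul_mul, mul_add, add_mul,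
      Matrix.smul_apply, Matrix.add_apply, Matrix.mul_single_mul_apply,
      Matrix.mul_single_mul_apply, add_comm, genericSymm_pow_apply_comm N m j i]
  have h1 (m : ℕ) (n : ℕ) : ∑ i, ∑ j, (genericSymm N ^ m) j j * (genericSymm N ^ n) i i =
      (genericSymm N ^ m).trace * (genericSymm N ^ n).trace := by
    rw [Finset.sum_comm]
    simp [Matrix.trace, Finset.sum_mul_sum]
  have h2 (m : ℕ) (n : ℕ) : ∑ i, ∑ j, (genericSymm N ^ m) i j * (genericSymm N ^ n) j i =
      (genericSymm N ^ (m + n)).trace := by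
    simp [pow_add, Matrix.trace, Matrix.mul_apply]
  simp_rw [h, ← Finset.smul_sum]
  congr 1
  simp_rw [Finset.sum_comm (t := Finset.range k), Finset.sum_add_distrib, h1, h2]
  congr 1
  rw [Finset.sum_congr rfl (g := fun _ => (genericSymm N ^ (k - 1)).trace)]
  · simp [MvPolynomial.smul_eq_C_mul]
  · intro m hm
    have := Finset.mem_range.1 hm
    congr 2
    omega

/-- The expectation of a polynomial in the entries of a GOE matrix. -/
noncomputable def goeExpectation (N : ℕ) : MvPolynomial (UpperIndex N) ℝ →ₗ[ℝ] ℝ where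
  toFun f := ∫ x, MvPolynomial.eval x f ∂gaussianMeasure (goeRate N)
  map_add' f g := by
    simp_rw [map_add]
    exact integral_add (integrable_eval_gaussianMeasure goeRate_pos f)
      (integrable_eval_gaussianMeasure goeRate_pos g)
  map_smul' c f := by
    simp_rw [MvPolynomial.smul_eval]
    exact integral_const_mul _ _

theorem goeExpectation_one (N : ℕ) : goeExpectation N 1 = 1 := by
  have := isProbabilityMeasure_gaussianMeasure (b := goeRate N) goeRate_pos
  simp [goeExpectation]

theorem goeExpectation_genericSymm_mul (N : ℕ) (i j : Fin N)
    (f : MvPolynomial (UpperIndex N) ℝ) :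
    goeExpectation N (genericSymm N i j * f) = goeExpectation N (entryDerivation i j f) := by
  rw [entryDerivation, Derivation.smul_apply, map_smul]
  exact integral_X_mul_gaussianMeasure goeRate_pos _ f

/-- The Schwinger–Dyson equation of the Gaussian orthogonal ensemble. -/
theorem goeExpectation_normTracePow_succ_mul (N k : ℕ) (f : MvPolynomial (UpperIndex N) ℝ) :
    goeExpectation N (normTracePow N (k + 1) * f) =
      ∑ m ∈ Finset.range k,
        goeExpectation N (normTracePow N m * (normTracePow N (k - 1 - m) * f)) +
      (k : ℝ) / N * goeExpectation N (normTracePow N (k - 1) * f) +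
      (N : ℝ)⁻¹ * goeExpectation N (powDerivation N k f) := by
  -- Integration by parts in the first factor of `∑ X_ij (X^k)_ji f`; the Leibniz rule separates the
  -- derivative of `X^k` from that of `f`.
  have h : goeExpectation N ((genericSymm N ^ (k + 1)).trace * f) =
      goeExpectation N ((∑ i, ∑ j, entryDerivation i j ((genericSymm N ^ k) j i)) * f +
        powDerivation N k f) := by
    rw [pow_succ']
    simp only [Matrix.trace, Matrix.diag, Matrix.mul_apply, powDerivation_apply, Finset.sum_mul,
      ← Finset.sum_add_distrib]
    simp only [map_sum, mul_assoc, goeExpectation_genericSymm_mul, Derivation.leibniz, smul_eq_mul]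
    refine Finset.sum_congr rfl fun i _ => Finset.sum_congr rfl fun j _ => ?_
    congr 1
    ring
  rw [normTracePow, smul_mul_assoc, map_smul, h, sum_entryDerivation_pow]
  simp only [normTracePow, smul_mul_assoc, mul_smul_comm, map_add, map_smul, add_mul,
    Finset.sum_mul, map_sum, smul_eq_mul, smul_add, mul_assoc, Finset.mul_sum, mul_add]
  ring

end GenericMatrix

/-! ### Limits of mixed moments and the Catalan recursion. -/

section MomentLimit

/-- The moments of the semicircle distribution. -/
def semicircleMoment (k : ℕ) : ℝ := if Even k then (catalan (k / 2) : ℝ) else 0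

theorem semicircleMoment_zero : semicircleMoment 0 = 1 := by simp [semicircleMoment]

theorem semicircleMoment_two_mul (n : ℕ) : semicircleMoment (2 * n) = catalan n := by
  simp [semicircleMoment]

theorem semicircleMoment_two_mul_add_one (n : ℕ) : semicircleMoment (2 * n + 1) = 0 := by
  simp [semicircleMoment]

theorem sum_range_two_mul_add_one {M : Type*} [AddCommMonoid M] (f : ℕ → M) (n : ℕ) :
    ∑ m ∈ Finset.range (2 * n + 1), f m =
      ∑ m ∈ Finset.range (n + 1), f (2 * m) + ∑ m ∈ Finset.range n, f (2 * m + 1) := by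
  induction n with
  | zero => simp
  | succ n ih =>
    rw [show 2 * (n + 1) + 1 = 2 * n + 1 + 1 + 1 by ring, Finset.sum_range_succ,
      Finset.sum_range_succ, ih, Finset.sum_range_succ _ (n + 1),
      Finset.sum_range_succ (fun m => f (2 * m + 1)) n,
      show 2 * n + 1 + 1 = 2 * (n + 1) by ring]
    abel

/-- For even `k`, the indices `m` and `k - 1 - m` have opposite parity, so every term vanishes. For
odd `k`, only even `m` survive, which is Segner's recursion for the Catalan numbers. -/
theorem semicircleMoment_succ (k : ℕ) :
    semicircleMoment (k + 1) =
      ∑ m ∈ Finset.range k, semicircleMoment m * semicircleMoment (k - 1 - m) := by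
  rcases Nat.even_or_odd' k with ⟨n, rfl | rfl⟩
  · rw [semicircleMoment_two_mul_add_one, eq_comm]
    refine Finset.sum_eq_zero fun m hm => ?_
    have := Finset.mem_range.1 hm
    rcases Nat.even_or_odd' m with ⟨l, rfl | rfl⟩
    · rw [show 2 * n - 1 - 2 * l = 2 * (n - 1 - l) + 1 by omega,
        semicircleMoment_two_mul_add_one, mul_zero]
    · rw [semicircleMoment_two_mul_add_one, zero_mul]
  · rw [show 2 * n + 1 + 1 = 2 * (n + 1) by ring, semicircleMoment_two_mul,
      sum_range_two_mul_add_one, catalan_succ, Finset.sum_range]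
    simp_rw [semicircleMoment_two_mul_add_one, zero_mul, Finset.sum_const_zero, add_zero]
    push_cast
    refine Finset.sum_congr rfl fun m _ => ?_
    rw [show 2 * n - 2 * (m : ℕ) = 2 * (n - m) by omega, semicircleMoment_two_mul,
      semicircleMoment_two_mul]

theorem normTracePow_zero {N : ℕ} (hN : 1 ≤ N) : normTracePow N 0 = 1 := by
  have : (N : ℝ) ≠ 0 := by positivity
  rw [normTracePow, pow_zero, Matrix.trace_one, Fintype.card_fin, ← map_natCast (MvPolynomial.C),
    MvPolynomial.smul_eq_C_mul, ← map_mul, inv_mul_cancel₀ this, map_one]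

/-- By Leibniz, each term differentiates one trace and so gains a factor `2a/N` times a bounded
mixed moment. The list `l'` collects the factors already passed over. -/
theorem tendsto_goeExpectation_powDerivation_mul {n : ℕ}
    (h : ∀ l : List ℕ, l.sum < n → Tendsto
      (fun N => goeExpectation N (l.map (normTracePow N)).prod) atTop
      (𝓝 (l.map semicircleMoment).prod)) (k : ℕ) (l l' : List ℕ) (hl : k + l.sum + l'.sum < n) :
    Tendsto (fun N : ℕ => goeExpectation N (powDerivation N k (l.map (normTracePow N)).prod *
      (l'.map (normTracePow N)).prod)) atTop (𝓝 0) := by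
  induction l generalizing l' with
  | nil => simp
  | cons a l ih =>
    have h1 := ih (a :: l') (by simp at hl ⊢; omega)
    have h2 := h ((k + a - 1) :: (l ++ l')) (by simp at hl ⊢; omega)
    have h3 := ((tendsto_const_nhds (x := (2 * a : ℝ))).div_atTop
      tendsto_natCast_atTop_atTop).mul h2
    rw [zero_mul] at h3
    rw [← zero_add (0 : ℝ)]
    refine (h3.add h1).congr fun N => ?_
    rw [← smul_eq_mul, ← map_smul, ← map_add]
    congr 1
    simp only [List.map_cons, List.map_append, List.prod_cons, List.prod_append,
      Derivation.leibniz, powDerivation_normTracePow, smul_eq_mul, MvPolynomial.smul_eq_C_mul]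
    ring

/-- Mixed moments of normalized traces of GOE matrices factorize in the limit. -/
theorem tendsto_goeExpectation_prod (l : List ℕ) :
    Tendsto (fun N => goeExpectation N (l.map (normTracePow N)).prod) atTop
      (𝓝 (l.map semicircleMoment).prod) := by
  induction hn : l.sum using Nat.strong_induction_on generalizing l with
  | _ n IH =>
    have IH' (l : List ℕ) (hl : l.sum < n) := IH l.sum hl l rfl
    clear IH
    -- A leading exponent `0` does not lower the sum, so an inner induction on the list strips it
    -- off.
    induction l with
    | nil => simp [goeExpectation_one]
    | cons k l ih =>
      cases k with
      | zero =>
        simp only [List.sum_cons, zero_add] at hn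
        simp only [List.map_cons, List.prod_cons, semicircleMoment_zero, one_mul]
        refine (ih hn).congr' ?_
        filter_upwards [eventually_ge_atTop 1] with N hN
        rw [normTracePow_zero hN, one_mul]
      | succ k =>
        simp only [List.sum_cons] at hn
        simp only [List.map_cons, List.prod_cons, goeExpectation_normTracePow_succ_mul]
        have h1 : Tendsto (fun N : ℕ => ∑ m ∈ Finset.range k, goeExpectation N
            (normTracePow N m * (normTracePow N (k - 1 - m) * (l.map (normTracePow N)).prod)))
            atTop (𝓝 (∑ m ∈ Finset.range k, semicircleMoment m *
              (semicircleMoment (k - 1 - m) * (l.map semicircleMoment).prod))) := by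
          refine tendsto_finsetSum _ fun m hm => ?_
          have := Finset.mem_range.1 hm
          exact IH' (m :: (k - 1 - m) :: l) (by simp; omega)
        have h2 := ((tendsto_const_nhds (x := (k : ℝ))).div_atTop
          tendsto_natCast_atTop_atTop).mul (IH' ((k - 1) :: l) (by simp; omega))
        have h3 := (tendsto_inv_atTop_zero.comp (tendsto_natCast_atTop_atTop (R := ℝ))).mul
          (tendsto_goeExpectation_powDerivation_mul IH' k l [] (by simp; omega))
        convert (h1.add h2).add h3 using 1
        · simp
        · simp [semicircleMoment_succ, Finset.sum_mul, mul_assoc]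

theorem tendsto_goeExpectation_normTracePow (k : ℕ) :
    Tendsto (fun N => goeExpectation N (normTracePow N k)) atTop (𝓝 (semicircleMoment k)) := by
  simpa using tendsto_goeExpectation_prod [k]

end MomentLimit

/-! ### Moments of the semicircle distribution. -/

section Semicircle

theorem integral_semicircle (f : ℝ → ℝ) :
    ∫ x, f x ∂semicircle =
      (2 * Real.pi)⁻¹ * ∫ x in (-2 : ℝ)..2, f x * √(4 - x ^ 2) := by
  rw [semicircle, integral_withDensity_eq_integral_toReal_smul (by fun_prop) (by simp),
    intervalIntegral.integral_of_le (by norm_num), ← integral_Icc_eq_integral_Ioc,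
    ← integral_const_mul]
  congr with x
  rw [ENNReal.toReal_ofReal (by positivity), smul_eq_mul]
  ring

theorem integral_sqrt_four_sub_sq : ∫ x in (-2 : ℝ)..2, √(4 - x ^ 2) = 2 * Real.pi := by
  have h := intervalIntegral.integral_comp_mul_left (a := (-1 : ℝ)) (b := 1)
    (fun x : ℝ => √(4 - x ^ 2)) (two_ne_zero (α := ℝ))
  have h2 (x : ℝ) : √(4 - (2 * x) ^ 2) = 2 * √(1 - x ^ 2) := by
    rw [show 4 - (2 * x) ^ 2 = 2 ^ 2 * (1 - x ^ 2) by ring, Real.sqrt_mul (by norm_num),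
      Real.sqrt_sq (by norm_num)]
  simp_rw [h2, intervalIntegral.integral_const_mul, integral_sqrt_one_sub_sq] at h
  norm_num at h
  linarith

/-- Integrate the derivative of `x^(k+1) (4 - x²)^(3/2)`, which vanishes at `±2`. -/
theorem integral_pow_add_two_mul_sqrt (k : ℕ) :
    (k + 4) * ∫ x in (-2 : ℝ)..2, x ^ (k + 2) * √(4 - x ^ 2) =
      4 * (k + 1) * ∫ x in (-2 : ℝ)..2, x ^ k * √(4 - x ^ 2) := by
  have hd (x : ℝ) (hx : x ∈ Set.Ioo (-2 : ℝ) 2) :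
      HasDerivAt (fun x : ℝ => x ^ (k + 1) * ((4 - x ^ 2) * √(4 - x ^ 2)))
      (4 * (k + 1) * (x ^ k * √(4 - x ^ 2)) - (k + 4) * (x ^ (k + 2) * √(4 - x ^ 2))) x := by
    have hpos : 0 < 4 - x ^ 2 := by nlinarith [hx.1, hx.2]
    have h1 : HasDerivAt (fun x : ℝ => 4 - x ^ 2) (-(2 * x)) x := by
      simpa using (hasDerivAt_pow 2 x).const_sub 4
    have h := (hasDerivAt_pow (k + 1) x).mul (h1.mul (h1.sqrt hpos.ne'))
    refine h.congr_deriv ?_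
    have h2 : (4 - x ^ 2) * (-(2 * x) / (2 * √(4 - x ^ 2))) = -x * √(4 - x ^ 2) := by
      rw [neg_div, mul_div_mul_left _ _ two_ne_zero]
      linear_combination (-x) * Real.div_sqrt (x := 4 - x ^ 2)
    simp only [Pi.mul_apply, h2]
    push_cast
    ring
  have hi (m : ℕ) : IntervalIntegrable (fun x : ℝ => x ^ m * √(4 - x ^ 2)) volume (-2) 2 :=
    Continuous.intervalIntegrable (by fun_prop) _ _
  have h := intervalIntegral.integral_eq_sub_of_hasDerivAt_of_le (by norm_num)
    (by fun_prop) hd (((hi k).const_mul _).sub ((hi (k + 2)).const_mul _))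
  rw [intervalIntegral.integral_sub ((hi k).const_mul _) ((hi (k + 2)).const_mul _),
    intervalIntegral.integral_const_mul, intervalIntegral.integral_const_mul] at h
  norm_num at h
  linarith

theorem integral_odd_pow_mul_sqrt (n : ℕ) :
    ∫ x in (-2 : ℝ)..2, x ^ (2 * n + 1) * √(4 - x ^ 2) = 0 := by
  have h := intervalIntegral.integral_comp_neg (a := (-2 : ℝ)) (b := 2)
    fun x : ℝ => x ^ (2 * n + 1) * √(4 - x ^ 2)
  simp only [neg_neg, neg_sq, (odd_two_mul_add_one n).neg_pow, neg_mul,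
    intervalIntegral.integral_neg] at h
  linarith

theorem integral_pow_semicircle (k : ℕ) : ∫ x, x ^ k ∂semicircle = semicircleMoment k := by
  rcases Nat.even_or_odd' k with ⟨n, rfl | rfl⟩
  · rw [semicircleMoment_two_mul]
    induction n with
    | zero =>
      rw [integral_semicircle]
      simp only [mul_zero, pow_zero, one_mul, integral_sqrt_four_sub_sq, catalan_zero]
      field_simp
      simp
    | succ n ih =>
      rw [integral_semicircle] at ih ⊢
      have h := integral_pow_add_two_mul_sqrt (2 * n)
      have h1 : ((n : ℝ) + 1) * catalan n = n.centralBinom := by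
        exact_mod_cast succ_mul_catalan_eq_centralBinom n
      have h2 : ((n : ℝ) + 1 + 1) * catalan (n + 1) = (n + 1).centralBinom := by
        exact_mod_cast succ_mul_catalan_eq_centralBinom (n + 1)
      have h3 : ((n : ℝ) + 1) * (n + 1).centralBinom = 2 * (2 * n + 1) * n.centralBinom := by
        exact_mod_cast Nat.succ_mul_centralBinom_succ n
      have h4 : ((n : ℝ) + 2) * catalan (n + 1) = 2 * (2 * n + 1) * catalan n := by
        have : (n : ℝ) + 1 ≠ 0 := by positivity
        apply mul_left_cancel₀ this
        rw [← h1, ← h2] at h3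
        linarith
      have : (n : ℝ) + 2 ≠ 0 := by positivity
      apply mul_left_cancel₀ this
      rw [h4, ← ih]
      push_cast at h
      rw [show 2 * (n + 1) = 2 * n + 2 by ring]
      linear_combination (2 * Real.pi)⁻¹ * h / 2
  · rw [semicircleMoment_two_mul_add_one, integral_semicircle, integral_odd_pow_mul_sqrt, mul_zero]

theorem isProbabilityMeasure_semicircle : IsProbabilityMeasure semicircle := by
  have h := integral_pow_semicircle 0
  simp only [pow_zero, integral_const, smul_eq_mul, mul_one, semicircleMoment_zero] at h
  exact isProbabilityMeasure_iff_real.2 h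

theorem ae_mem_Icc_semicircle : ∀ᵐ x ∂semicircle, x ∈ Set.Icc (-2 : ℝ) 2 :=
  (withDensity_absolutelyContinuous _ _).ae_le (ae_restrict_mem measurableSet_Icc)

theorem integrable_semicircle {f : ℝ → ℝ} (hf : Continuous f) : Integrable f semicircle := by
  have := isProbabilityMeasure_semicircle
  obtain ⟨C, hC⟩ := isCompact_Icc.exists_bound_of_continuousOn
    (hf.continuousOn (s := Set.Icc (-2 : ℝ) 2))
  exact Integrable.of_bound hf.aestronglyMeasurable C (ae_mem_Icc_semicircle.mono hC)

end Semicircle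

/-! ### From convergence of moments to weak convergence. -/

section MomentMethod

theorem Polynomial.exists_abs_eval_le_of_one_le (p : Polynomial ℝ) :
    ∃ C d, 0 ≤ C ∧ ∀ x : ℝ, 1 ≤ |x| → |p.eval x| ≤ C * x ^ (2 * d) := by
  refine ⟨∑ i ∈ Finset.range (p.natDegree + 1), |p.coeff i|, p.natDegree,
    Finset.sum_nonneg fun _ _ => abs_nonneg _, fun x hx => ?_⟩
  rw [Polynomial.eval_eq_sum_range, Finset.sum_mul]
  refine (Finset.abs_sum_le_sum_abs _ _).trans (Finset.sum_le_sum fun i hi => ?_)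
  rw [abs_mul, abs_pow]
  refine mul_le_mul_of_nonneg_left ?_ (abs_nonneg _)
  rw [← (even_two_mul p.natDegree).pow_abs]
  have := Finset.mem_range.1 hi
  exact pow_le_pow_right₀ hx (by omega)

/-- A bounded continuous function is uniformly close to a polynomial up to a multiple of a
high even power which is small on `[-2, 2]`. -/
theorem exists_polynomial_abs_sub_le (f : ℝ →ᵇ ℝ) {ε : ℝ} (hε : 0 < ε) :
    ∃ (p : Polynomial ℝ) (c : ℝ) (K : ℕ), 0 ≤ c ∧ c * 4 ^ K ≤ ε ∧
      ∀ x, |f x - p.eval x| ≤ ε + c * x ^ (2 * K) := by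
  obtain ⟨p, hp⟩ := exists_polynomial_near_of_continuousOn (-3) 3 f f.continuous.continuousOn ε hε
  obtain ⟨C, d, hC, hd⟩ := p.exists_abs_eval_le_of_one_le
  have hlim : Tendsto (fun K : ℕ => (‖f‖ + C) * 9 ^ d * (4 / 9 : ℝ) ^ K) atTop (𝓝 0) := by
    simpa using (tendsto_pow_atTop_nhds_zero_of_lt_one (r := (4 / 9 : ℝ)) (by norm_num)
      (by norm_num)).const_mul ((‖f‖ + C) * 9 ^ d)
  obtain ⟨K, hK, hdK⟩ := ((hlim.eventually_le_const hε).and (eventually_ge_atTop d)).exists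
  have hf0 := norm_nonneg f
  -- For `|x| ≥ 3` and `d ≤ K`, `x^(2d) ≤ 9^d x^(2K) / 9^K`, which dictates `c`. Then `c * 4^K` is a
  -- constant times `(4/9)^K`: the gap between 2 and 3 makes it small.
  refine ⟨p, (‖f‖ + C) * 9 ^ d / 9 ^ K, K, by positivity, ?_, fun x => ?_⟩
  · rw [div_pow] at hK
    refine (le_of_eq ?_).trans hK
    ring
  · by_cases hx : |x| ≤ 3
    · have h := (hp x (abs_le.1 hx)).le
      rw [abs_sub_comm] at h
      have : 0 ≤ x ^ (2 * K) := (even_two_mul K).pow_nonneg x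
      have : 0 ≤ (‖f‖ + C) * 9 ^ d / 9 ^ K * x ^ (2 * K) := by positivity
      linarith
    · push Not at hx
      have h1 : |f x| ≤ ‖f‖ := f.norm_coe_le_norm x
      have h2 := hd x (by linarith)
      have h9 : 9 ≤ x ^ 2 := by rw [← sq_abs]; nlinarith
      have h3 : 1 ≤ x ^ (2 * d) := by
        rw [pow_mul]; exact one_le_pow₀ (by linarith)
      have h4 : x ^ (2 * d) * 9 ^ K ≤ 9 ^ d * x ^ (2 * K) := by
        obtain ⟨e, rfl⟩ := Nat.exists_eq_add_of_le hdK
        rw [pow_mul, pow_mul, pow_add, pow_add]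
        have := pow_le_pow_left₀ (by norm_num) h9 e
        have h0 : 0 ≤ (x ^ 2) ^ d * 9 ^ d := by positivity
        nlinarith [mul_le_mul_of_nonneg_left this h0]
      calc |f x - p.eval x| ≤ |f x| + |p.eval x| := abs_sub _ _
        _ ≤ ‖f‖ * x ^ (2 * d) + C * x ^ (2 * d) := by nlinarith
        _ = (‖f‖ + C) * x ^ (2 * d) := by ring
        _ ≤ (‖f‖ + C) * (9 ^ d * x ^ (2 * K) / 9 ^ K) := by
            refine mul_le_mul_of_nonneg_left ?_ (by positivity)
            rwa [le_div_iff₀ (by positivity)]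
        _ = (‖f‖ + C) * 9 ^ d / 9 ^ K * x ^ (2 * K) := by ring
        _ ≤ _ := by linarith

theorem integrable_polynomial_eval {μ : Measure ℝ} (h : ∀ k : ℕ, Integrable (fun x => x ^ k) μ)
    (p : Polynomial ℝ) : Integrable (fun x => p.eval x) μ := by
  simp_rw [Polynomial.eval_eq_sum_range]
  exact integrable_finsetSum _ fun k _ => (h k).const_mul _

theorem integral_polynomial_eval {μ : Measure ℝ} (h : ∀ k : ℕ, Integrable (fun x => x ^ k) μ)
    (p : Polynomial ℝ) :
    ∫ x, p.eval x ∂μ = ∑ k ∈ Finset.range (p.natDegree + 1), p.coeff k * ∫ x, x ^ k ∂μ := by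
  simp_rw [Polynomial.eval_eq_sum_range]
  rw [integral_finsetSum _ fun k _ => (h k).const_mul _]
  simp_rw [integral_const_mul]

theorem abs_integral_sub_le {μ : Measure ℝ} [IsProbabilityMeasure μ]
    (h : ∀ k : ℕ, Integrable (fun x => x ^ k) μ) (f : ℝ →ᵇ ℝ) (p : Polynomial ℝ) {ε c : ℝ} {K : ℕ}
    (hp : ∀ x, |f x - p.eval x| ≤ ε + c * x ^ (2 * K)) :
    |∫ x, f x ∂μ - ∫ x, p.eval x ∂μ| ≤ ε + c * ∫ x, x ^ (2 * K) ∂μ := by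
  rw [← integral_sub (f.integrable μ) (integrable_polynomial_eval h p)]
  refine (abs_integral_le_integral_abs).trans ((integral_mono
    ((f.integrable μ).sub (integrable_polynomial_eval h p)).abs
    ((integrable_const ε).add ((h _).const_mul c)) hp).trans_eq ?_)
  simp only [Pi.add_apply]
  rw [integral_add (integrable_const ε) ((h _).const_mul c), integral_const_mul]
  simp

/-- The method of moments for convergence to the semicircle distribution. -/
theorem tendsto_integral_semicircle_of_moments {μ : ℕ → Measure ℝ}
    (hμ : ∀ᶠ N in atTop, IsProbabilityMeasure (μ N))
    (hint : ∀ᶠ N in atTop, ∀ k : ℕ, Integrable (fun x => x ^ k) (μ N))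
    (hmom : ∀ k : ℕ, Tendsto (fun N => ∫ x, x ^ k ∂μ N) atTop (𝓝 (semicircleMoment k))) :
    ConvergesWeakly μ semicircle := by
  intro f
  have := isProbabilityMeasure_semicircle
  have hsint (k : ℕ) : Integrable (fun x : ℝ => x ^ k) semicircle :=
    integrable_semicircle (by fun_prop)
  rw [Metric.tendsto_nhds]
  intro δ hδ
  -- Error budget in units of `δ/7`: 2 for the semicircle, 3 for `μ N`, 1 for the polynomial
  -- integrals, hence 6 in total.
  obtain ⟨p, c, K, hc, hcK, hp⟩ := exists_polynomial_abs_sub_le f (ε := δ / 7) (by positivity)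
  have hK : semicircleMoment (2 * K) ≤ 4 ^ K := by
    rw [← integral_pow_semicircle]
    calc _ ≤ ∫ x, (4 : ℝ) ^ K ∂semicircle := by
          refine integral_mono_ae (hsint _) (integrable_const _) ?_
          filter_upwards [ae_mem_Icc_semicircle] with x hx
          rw [pow_mul]
          exact pow_le_pow_left₀ (sq_nonneg x) (by nlinarith [hx.1, hx.2]) K
      _ = 4 ^ K := by simp
  have hcK' : c * semicircleMoment (2 * K) ≤ δ / 7 :=
    (mul_le_mul_of_nonneg_left hK hc).trans hcK
  have hpoly : Tendsto (fun N => ∫ x, p.eval x ∂μ N) atTop (𝓝 (∫ x, p.eval x ∂semicircle)) := by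
    rw [integral_polynomial_eval hsint]
    refine (tendsto_finsetSum _ fun k _ => ?_ : Tendsto (fun N =>
      ∑ k ∈ Finset.range (p.natDegree + 1), p.coeff k * ∫ x, x ^ k ∂μ N) _ _).congr' ?_
    · rw [integral_pow_semicircle]
      exact (hmom k).const_mul _
    · filter_upwards [hint] with N hN
      rw [integral_polynomial_eval hN]
  have hs := abs_integral_sub_le hsint f p hp
  rw [integral_pow_semicircle] at hs
  have hcm := (hmom (2 * K)).const_mul c
  filter_upwards [hμ, hint, Metric.tendsto_nhds.1 hpoly (δ / 7) (by positivity),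
    hcm.eventually_lt_const (u := 2 * (δ / 7)) (by linarith)] with N h1 h2 h3 h4
  have hN := abs_integral_sub_le h2 f p hp
  rw [Real.dist_eq] at h3 ⊢
  rw [abs_le] at hs hN
  rw [abs_lt] at h3 ⊢
  constructor <;> linarith [hs.1, hs.2, hN.1, hN.2, h3.1, h3.2]

end MomentMethod

/-! ### Moments and measurability of the eigenvalue distribution. -/

section EigenvalueDistribution

theorem Matrix.IsHermitian.trace_pow_eq_sum_eigenvalues_pow {n : Type*} [Fintype n] [DecidableEq n]
    {A : Matrix n n ℝ} (hA : A.IsHermitian) (k : ℕ) :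
    (A ^ k).trace = ∑ i, hA.eigenvalues i ^ k := by
  conv_lhs => rw [hA.spectral_theorem, ← map_pow, Matrix.diagonal_pow,
    Unitary.conjStarAlgAut_apply, Matrix.trace_mul_cycle, Unitary.coe_star_mul_self, one_mul]
  simp [Matrix.trace]

variable {N : ℕ}

theorem isProbabilityMeasure_eigenvalueDistribution (hN : 1 ≤ N) (A : SymmMatrix N) :
    IsProbabilityMeasure (eigenvalueDistribution A) := by
  constructor
  have : (N : ℝ≥0∞) ≠ 0 := by exact_mod_cast (by omega : N ≠ 0)
  simp [eigenvalueDistribution, ENNReal.inv_mul_cancel this]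

theorem integrable_eigenvalueDistribution (hN : 1 ≤ N) (A : SymmMatrix N) (f : ℝ → ℝ) :
    Integrable f (eigenvalueDistribution A) := by
  have : (N : ℝ≥0∞) ≠ 0 := by exact_mod_cast (by omega : N ≠ 0)
  refine Integrable.smul_measure ?_ (ENNReal.inv_ne_top.2 this)
  exact integrable_finsetSum_measure.2 fun i _ => integrable_dirac (by simp)

theorem integral_eigenvalueDistribution (A : SymmMatrix N) (f : ℝ → ℝ) :
    ∫ x, f x ∂eigenvalueDistribution A = (N : ℝ)⁻¹ * ∑ i, f (A.isHermitian.eigenvalues i) := by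
  rw [eigenvalueDistribution, integral_smul_measure, integral_finsetSum_measure]
  · simp
  · exact fun i _ => integrable_dirac (by simp)

theorem integral_pow_eigenvalueDistribution (A : SymmMatrix N) (k : ℕ) :
    ∫ x, x ^ k ∂eigenvalueDistribution A = (N : ℝ)⁻¹ * (A.1 ^ k).trace := by
  rw [integral_eigenvalueDistribution, A.isHermitian.trace_pow_eq_sum_eigenvalues_pow]

theorem measurable_symmMatrix_apply (i j : Fin N) : Measurable fun A : SymmMatrix N => A.1 i j :=
  (measurable_pi_apply j).comp ((measurable_pi_apply i).comp measurable_subtype_coe)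

theorem measurable_trace_pow (k : ℕ) : Measurable fun A : SymmMatrix N => (A.1 ^ k).trace := by
  have h (i j : Fin N) : Measurable fun A : SymmMatrix N => (A.1 ^ k) i j := by
    induction k generalizing i j with
    | zero => simp
    | succ k ih =>
      simp_rw [pow_succ, Matrix.mul_apply]
      exact Finset.measurable_fun_sum _ fun l _ => (ih i l).mul (measurable_symmMatrix_apply l j)
  exact Finset.measurable_fun_sum _ fun i _ => h i i

/-- This avoids measurability of individual eigenvalues: for polynomial `f` the integral is a
combination of traces of powers, and a continuous `f` is a pointwise limit of polynomials. -/
theorem measurable_integral_eigenvalueDistribution (hN : 1 ≤ N) {f : ℝ → ℝ} (hf : Continuous f) :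
    Measurable fun A : SymmMatrix N => ∫ x, f x ∂eigenvalueDistribution A := by
  choose p hp using fun n : ℕ => exists_polynomial_near_of_continuousOn (-n : ℝ) n f
    hf.continuousOn (1 / ((n : ℝ) + 1)) (by positivity)
  have hpt (x : ℝ) : Tendsto (fun n => (p n).eval x) atTop (𝓝 (f x)) := by
    rw [tendsto_iff_dist_tendsto_zero]
    refine squeeze_zero' (Eventually.of_forall fun _ => dist_nonneg) ?_
      tendsto_one_div_add_atTop_nhds_zero_nat
    filter_upwards [eventually_ge_atTop ⌈|x|⌉₊] with n hn
    exact (hp n x (abs_le.1 (Nat.ceil_le.1 hn))).le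
  refine measurable_of_tendsto_metrizable
    (f := fun n (A : SymmMatrix N) => ∫ x, (p n).eval x ∂eigenvalueDistribution A) (fun n => ?_) ?_
  · simp_rw [integral_polynomial_eval fun k => integrable_eigenvalueDistribution hN _ _,
      integral_pow_eigenvalueDistribution]
    exact Finset.measurable_fun_sum _ fun k _ => ((measurable_trace_pow k).const_mul _).const_mul _
  · rw [tendsto_pi_nhds]
    intro A
    simp_rw [integral_eigenvalueDistribution]
    exact (tendsto_finsetSum _ fun i _ => hpt _).const_mul _

/-- Closed sets form a generating π-system, and their indicators are limits of bounded continuous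
functions, to which the previous lemma applies. -/
theorem measurable_eigenvalueDistribution (hN : 1 ≤ N) :
    Measurable (eigenvalueDistribution : SymmMatrix N → Measure ℝ) := by
  have := isProbabilityMeasure_eigenvalueDistribution hN
  refine Measurable.measure_of_isPiSystem_of_isProbabilityMeasure
    (borel_eq_generateFrom_isClosed (α := ℝ) ▸ BorelSpace.measurable_eq) isPiSystem_isClosed
    fun F hF => ?_
  have hF : IsClosed F := hF
  refine measurable_of_tendsto_metrizable (f := fun n (A : SymmMatrix N) =>
    ∫⁻ x, hF.apprSeq n x ∂eigenvalueDistribution A) (fun n => ?_) ?_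
  · have h := measurable_integral_eigenvalueDistribution hN (f := fun x => (hF.apprSeq n x : ℝ))
      (by fun_prop)
    convert h.ennreal_ofReal with A
    rw [← BoundedContinuousFunction.toReal_lintegral_coe_eq_integral, ENNReal.ofReal_toReal]
    exact (BoundedContinuousFunction.lintegral_lt_top_of_nnreal _ _).ne
  · rw [tendsto_pi_nhds]
    exact fun A => HasOuterApproxClosed.tendsto_lintegral_apprSeq hF _

end EigenvalueDistribution

/-! ### Transfer from Gaussian coordinates to the matrix law. -/

section GOE

variable {N : ℕ}

theorem measurable_symmOfUpper (N : ℕ) : Measurable (symmOfUpper N) := by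
  refine Measurable.subtype_mk (measurable_pi_iff.2 fun i => measurable_pi_iff.2 fun j => ?_)
  exact measurable_pi_apply _

theorem trace_sq_symmOfUpper (x : UpperIndex N → ℝ) :
    (N : ℝ) / 4 * ((symmOfUpper N x).1 ^ 2).trace = ∑ p, goeRate N p * x p ^ 2 := by
  set h : Fin N × Fin N → ℝ := fun q =>
    (N : ℝ) / 4 * x ⟨(min q.1 q.2, max q.1 q.2), min_le_max⟩ ^ 2 with hh
  have h1 : (N : ℝ) / 4 * ((symmOfUpper N x).1 ^ 2).trace = ∑ q, h q := by
    rw [Fintype.sum_prod_type]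
    simp [hh, Matrix.trace, sq, Matrix.mul_apply, symmOfUpper, Finset.mul_sum, min_comm, max_comm]
  -- Transposition folds the entries below the diagonal onto those above it, doubling the
  -- off-diagonal coefficients.
  have h2 : ∑ q with ¬ q.1 ≤ q.2, h q = ∑ q with q.1 ≤ q.2, if q.1 = q.2 then 0 else h q := by
    rw [Finset.sum_ite, Finset.sum_const_zero, zero_add, Finset.filter_filter]
    refine Finset.sum_nbij' Prod.swap Prod.swap ?_ ?_ (by simp) (by simp) ?_
    · simp only [Finset.mem_filter, Finset.mem_univ, true_and, Prod.fst_swap, Prod.snd_swap]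
      intro q hq
      omega
    · simp only [Finset.mem_filter, Finset.mem_univ, true_and, Prod.fst_swap, Prod.snd_swap]
      intro q hq
      omega
    · simp [hh, min_comm, max_comm]
  rw [h1, ← Finset.sum_filter_add_sum_filter_not Finset.univ (fun q => q.1 ≤ q.2), h2,
    ← Finset.sum_add_distrib, Finset.sum_subtype (p := fun q => q.1 ≤ q.2) _ (by simp)]
  refine Finset.sum_congr rfl fun p _ => ?_
  have hp : (⟨(min p.1.1 p.1.2, max p.1.1 p.1.2), min_le_max⟩ : UpperIndex N) = p := by
    ext <;> simp [p.2]
  simp only [hh, hp, goeRate]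
  split_ifs <;> ring

theorem goeWeight_symmOfUpper (x : UpperIndex N → ℝ) :
    goeWeight N (symmOfUpper N x) = ENNReal.ofReal (gaussianWeight (goeRate N) x) := by
  rw [goeWeight, gaussianWeight, neg_mul, trace_sq_symmOfUpper]

theorem measurable_goeWeight (N : ℕ) : Measurable (goeWeight N) :=
  (((measurable_trace_pow 2).const_mul _).exp).ennreal_ofReal

theorem goe_eq_map_gaussianMeasure (N : ℕ) :
    goe N = (gaussianMeasure (goeRate N)).map (symmOfUpper N) := by
  rw [goe, gaussianMeasure, Measure.map_smul, symmLebesgue,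
    lintegral_map (measurable_goeWeight N) (measurable_symmOfUpper N)]
  simp_rw [goeWeight_symmOfUpper]
  congr 1
  ext s hs
  rw [withDensity_apply _ hs, setLIntegral_map hs (measurable_goeWeight N) (measurable_symmOfUpper N),
    Measure.map_apply (measurable_symmOfUpper N) hs,
    withDensity_apply _ (measurable_symmOfUpper N hs)]
  simp_rw [goeWeight_symmOfUpper]

theorem isProbabilityMeasure_goe (N : ℕ) : IsProbabilityMeasure (goe N) := by
  have := isProbabilityMeasure_gaussianMeasure (b := goeRate N) goeRate_pos
  rw [goe_eq_map_gaussianMeasure]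
  exact Measure.isProbabilityMeasure_map (measurable_symmOfUpper N).aemeasurable

theorem integrable_trace_pow_goe (N k : ℕ) :
    Integrable (fun A : SymmMatrix N => (A.1 ^ k).trace) (goe N) := by
  rw [goe_eq_map_gaussianMeasure, integrable_map_measure
    (measurable_trace_pow k).aestronglyMeasurable (measurable_symmOfUpper N).aemeasurable]
  simpa only [Function.comp_def, eval_trace_genericSymm_pow] using
    integrable_eval_gaussianMeasure goeRate_pos (genericSymm N ^ k).trace

theorem integral_trace_pow_goe (N k : ℕ) :
    ∫ A : SymmMatrix N, (N : ℝ)⁻¹ * (A.1 ^ k).trace ∂goe N =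
      goeExpectation N (normTracePow N k) := by
  rw [goe_eq_map_gaussianMeasure, integral_map (measurable_symmOfUpper N).aemeasurable
    ((measurable_trace_pow k).const_mul _).aestronglyMeasurable, normTracePow, map_smul,
    integral_const_mul]
  simp_rw [← eval_trace_genericSymm_pow]
  rfl

/-- The Markov kernel sending a symmetric matrix to its eigenvalue distribution. -/
noncomputable def eigenvalueKernel (hN : 1 ≤ N) : Kernel (SymmMatrix N) ℝ :=
  ⟨eigenvalueDistribution, measurable_eigenvalueDistribution hN⟩

instance isMarkovKernel_eigenvalueKernel (hN : 1 ≤ N) : IsMarkovKernel (eigenvalueKernel hN) :=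
  ⟨isProbabilityMeasure_eigenvalueDistribution hN⟩

theorem averagedEigenvalueDistribution_eq {Ω : Type*} [MeasurableSpace Ω] {P : Measure Ω}
    {A : Ω → SymmMatrix N} (hN : 1 ≤ N) (hA : HasLaw A (goe N) P) :
    averagedEigenvalueDistribution P A = (goe N).bind (eigenvalueKernel hN) := by
  rw [averagedEigenvalueDistribution, Measure.bind, Measure.bind, ← hA.map_eq,
    AEMeasurable.map_map_of_aemeasurable (eigenvalueKernel hN).measurable.aemeasurable
      hA.aemeasurable]
  rfl

/-- The bound `|x^k| ≤ 1 + x^(2k)` replaces an absolute moment, which is not a trace, by an even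
one, which is. -/
theorem integrable_pow_bind_eigenvalueKernel (hN : 1 ≤ N) (k : ℕ) :
    Integrable (fun x => x ^ k) ((goe N).bind (eigenvalueKernel hN)) := by
  have := isProbabilityMeasure_goe N
  rw [Measure.integrable_comp_iff (by fun_prop)]
  refine ⟨ae_of_all _ fun A => integrable_eigenvalueDistribution hN A _, ?_⟩
  refine ((integrable_const (1 : ℝ)).add
    ((integrable_trace_pow_goe N (2 * k)).const_mul (N : ℝ)⁻¹)).mono'
    (measurable_integral_eigenvalueDistribution hN
      (f := fun x => ‖x ^ k‖) (by fun_prop)).aestronglyMeasurable (ae_of_all _ fun A => ?_)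
  have := isProbabilityMeasure_eigenvalueDistribution hN A
  rw [Real.norm_of_nonneg (integral_nonneg fun _ => norm_nonneg _), Pi.add_apply,
    ← integral_pow_eigenvalueDistribution]
  calc ∫ x, ‖x ^ k‖ ∂eigenvalueDistribution A
      ≤ ∫ x, (1 + x ^ (2 * k)) ∂eigenvalueDistribution A := by
        refine integral_mono (integrable_eigenvalueDistribution hN A _)
          (integrable_eigenvalueDistribution hN A _) fun x => ?_
        simp only [Real.norm_eq_abs]
        rw [mul_comm, pow_mul, ← sq_abs (x ^ k)]
        nlinarith [sq_nonneg (|x ^ k| - 1)]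
    _ = _ := by
        rw [integral_add (integrable_const _) (integrable_eigenvalueDistribution hN A _)]
        simp

theorem integral_pow_bind_eigenvalueKernel (hN : 1 ≤ N) (k : ℕ) :
    ∫ x, x ^ k ∂(goe N).bind (eigenvalueKernel hN) = goeExpectation N (normTracePow N k) := by
  have h := integrable_pow_bind_eigenvalueKernel hN k
  rw [Measure.comp_eq_comp_const_apply] at h ⊢
  rw [Kernel.integral_comp h, Kernel.const_apply, ← integral_trace_pow_goe]
  exact integral_congr_ae (ae_of_all _ fun A => integral_pow_eigenvalueDistribution A k)

end GOE

theorem theorem5p5 {Ω : ℕ → Type*} [∀ N, MeasurableSpace (Ω N)]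
    (P : ∀ N, Measure (Ω N)) (A : ∀ N, Ω N → SymmMatrix N)
    (hA : ∀ N, 1 ≤ N → HasLaw (A N) (goe N) (P N)) :
    (∀ N, 1 ≤ N → IsProbabilityMeasure (averagedEigenvalueDistribution (P N) (A N))) ∧
      IsProbabilityMeasure semicircle ∧
      ConvergesWeakly (fun N => averagedEigenvalueDistribution (P N) (A N)) semicircle := by
  have hprob (N : ℕ) (hN : 1 ≤ N) :
      IsProbabilityMeasure (averagedEigenvalueDistribution (P N) (A N)) := by
    have := isProbabilityMeasure_goe N
    rw [averagedEigenvalueDistribution_eq hN (hA N hN)]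
    infer_instance
  refine ⟨hprob, isProbabilityMeasure_semicircle, tendsto_integral_semicircle_of_moments
    ((eventually_ge_atTop 1).mono hprob) ?_ fun k => ?_⟩
  · filter_upwards [eventually_ge_atTop 1] with N hN k
    rw [averagedEigenvalueDistribution_eq hN (hA N hN)]
    exact integrable_pow_bind_eigenvalueKernel hN k
  · refine (tendsto_goeExpectation_normTracePow k).congr' ?_
    filter_upwards [eventually_ge_atTop 1] with N hN
    rw [averagedEigenvalueDistribution_eq hN (hA N hN), integral_pow_bind_eigenvalueKernel]
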